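/- **Setting.** Let $n,m\ge 0$ with $n+m\ge 1$ and let $Y,Y'$ be smooth (Hausdorff, second countable) manifolds of dimension $n+m$ with (possibly empty) boundaries $\partial Y,\partial Y'$. Let $G_n^\infty Y$ be the bundle over $Y$ of $\infty$-jets of $n$-dimensional submanifolds of $Y$, and let $\partial G_n^\infty Y$ be the preimage of $\partial Y$ under the projection $G_n^\infty Y\to Y$. Smooth functions and differential forms $\Omega^k(G_n^\infty Y)$ on $G_n^\infty Y$ are those coming from some finite-order jet space $G_n^rY$. Let $\Omega^k_{\mathrm{rel}}(Y)\subseteq\Omega^k(G_n^\infty Y)$ be the space of relative forms, i.e. of forms whose restriction (pullback) to $\partial G_n^\infty Y$ is zero. Let $C^p\Omega^k(Y)\subseteq \Omega^k(G_n^\infty Y)$ be the degree-$k$ part of the $p$-th power of the contact ideal, which is generated by the $1$-forms whose pullback along $j^\infty L$ vanishes for every $n$-dimensional submanifold $L\subseteq Y$, and put $C^p\Omega^k_{\mathrm{rel}}=C^p\Omega^k\cap\Omega^k_{\mathrm{rel}}$. This filters the complex $(\Omega^\bullet_{\mathrm{rel}}(Y),d)$; let $E_1^{p,q}(Y)$ be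 the first term of the associated (relative $\mathcal C$-) spectral sequence, i.e. the cohomology of $C^p\Omega_{\mathrm{rel}}/C^{p+1}\Omega_{\mathrm{rel}}$ in total degree $p+q$, with differential $d_1:E_1^{p,q}\to E_1^{p+1,q}$, $[\omega]\mapsto[d\omega]$. Put $$L(Y,\partial Y)=E_1^{0,n}(Y),\qquad K(Y,\partial Y)=E_1^{1,n}(Y).$$ Thus $L(Y,\partial Y)$ consists of relative horizontal $n$-forms modulo horizontal differentials of relative horizontal $(n-1)$-forms. The *relative Euler map* is $$\boldsymbol E^{\mathrm{rel}}_Y=d_1^{0,n}:L(Y,\partial Y)\to K(Y,\partial Y),\qquad [\lambda]\mapsto[d\lambda].$$ **Statement.** Let $F:Y\to Y'$ be a diffeomorphism which is boundary-friendly, i.e. $F(\partial Y)\subseteq\partial Y'$. Pullback of forms along the lift $G_n^\infty Y\to G_n^\infty Y'$ of $F$ induces linear maps $F^*:L(Y',\partial Y')\to L(Y,\partial Y)$ and $F^*:K(Y',\partial Y')\to K(Y,\partial Y)$; the first of them is bijective, and $$\boldsymbol E^{\mathrm{rel}}_Y=F^*\circ \boldsymbol E^{\mathrm{rel}}_{Y'}\circ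 (F^*)^{-1}.$$ -/

import Mathlib

open scoped Manifold ContDiff

noncomputable section

namespace RelEuler

/-! ## Exterior products of covectors -/

/-- The determinant, as a continuous alternating `k`-form on `ℝᵏ`. -/
def detForm (k : ℕ) : (Fin k → ℝ) [⋀^Fin k]→L[ℝ] ℝ :=
  { (Matrix.detRowAlternating : (Fin k → ℝ) [⋀^Fin k]→ₗ[ℝ] ℝ) with
    cont := by
      change Continuous fun v : Fin k → Fin k → ℝ => Matrix.det (Matrix.of v)
      exact Continuous.matrix_det continuous_id }

theorem detForm_apply (k : ℕ) (v : Fin k → Fin k → ℝ) : detForm k v = Matrix.det (Matrix.of v) :=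
  rfl

/-- The exterior product `α₁ ∧ ⋯ ∧ αₖ` of covectors, `(v₁, …, vₖ) ↦ det (αᵢ (vⱼ))`. -/
def wedge {E : Type*} [NormedAddCommGroup E] [NormedSpace ℝ E] {k : ℕ}
    (α : Fin k → (E →L[ℝ] ℝ)) : E [⋀^Fin k]→L[ℝ] ℝ :=
  (detForm k).compContinuousLinearMap (ContinuousLinearMap.pi α)

/-! ## The infinite Grassmann fibration

`Y` is a manifold with boundary of dimension `d`, modelled on the half space.  The `∞`-jet at `y`
of an `n`-dimensional submanifold `L` is encoded by the ideal of those smooth functions on `Y`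
whose restriction to `L` has vanishing Taylor series at `y`.  This ideal is the kernel of the
surjection `f ↦` (Taylor series of `f ∘ σ`), `C^∞(Y) → ℝ⟦t₁, …, tₙ⟧`, for any parametrization `σ`
of `L` near `y`; conversely such surjections are exactly the formal jets of immersions.  In this
way jets at boundary points of `Y` are included, with no condition on their position with respect
to the boundary. -/

section Jets

variable (n d : ℕ) [NeZero d] (Y : Type*) [TopologicalSpace Y]
  [ChartedSpace (EuclideanHalfSpace d) Y]

/-- The algebra of smooth real functions on `Y`. -/
abbrev SmoothFun : Type _ := C^∞⟮𝓡∂ d, Y; 𝓘(ℝ, ℝ), ℝ⟯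

/-- Formal parametrized jets: homomorphisms from `C^∞(Y)` to power series in `n` variables; they
are jets of immersions when surjective. -/
abbrev Velocity : Type _ := SmoothFun d Y →ₐ[ℝ] MvPowerSeries (Fin n) ℝ

/-- The Grassmann fibration `G_n^∞ Y` of `∞`-jets of `n`-dimensional submanifolds of `Y`. -/
def Grassmann : Type _ :=
  {𝔭 : Ideal (SmoothFun d Y) //
    ∃ φ : Velocity n d Y, Function.Surjective φ ∧ RingHom.ker φ = 𝔭}

variable {n d Y}

/-- The jet of a submanifold underlying a regular parametrized jet. -/
def Velocity.jet (φ : Velocity n d Y) (hφ : Function.Surjective φ) : Grassmann n d Y :=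
  ⟨RingHom.ker φ, φ, hφ, rfl⟩

/-- The jet `θ` lies over the point `y` of `Y`. -/
def Grassmann.LiesOver (θ : Grassmann n d Y) (y : Y) : Prop :=
  ∀ f ∈ θ.1, f y = 0

variable (n d Y)

/-- The boundary `∂G_n^∞ Y`: all jets over the points of `∂Y`. -/
def grassmannBoundary : Set (Grassmann n d Y) :=
  {θ | ∃ y ∈ (𝓡∂ d).boundary Y, θ.LiesOver y}

variable {n d Y}

/-- Smooth functions on `G_n^∞ Y`, i.e. smooth functions on some `G_n^r Y`: those which, near every
regular parametrized jet, are smooth functions of finitely many Taylor coefficients, of order at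
most `r`, of functions on `Y` along the jet. -/
def IsSmoothJetFun (h : Grassmann n d Y → ℝ) : Prop :=
  ∃ r : ℕ, ∀ φ : Velocity n d Y, Function.Surjective φ →
    ∃ (N : ℕ) (f : Fin N → SmoothFun d Y) (I : Fin N → (Fin n →₀ ℕ)) (g : (Fin N → ℝ) → ℝ) (ε : ℝ),
      (∀ k, (I k).degree ≤ r) ∧ ContDiff ℝ ∞ g ∧ 0 < ε ∧
      ∀ (ψ : Velocity n d Y) (hψ : Function.Surjective ψ),
        (∀ k, |MvPowerSeries.coeff (I k) (ψ (f k)) - MvPowerSeries.coeff (I k) (φ (f k))| < ε) →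
        h (ψ.jet hψ) = g fun k => MvPowerSeries.coeff (I k) (ψ (f k))

theorem isSmoothJetFun_one : IsSmoothJetFun (fun _ : Grassmann n d Y => (1 : ℝ)) :=
  ⟨0, fun _ _ => ⟨0, Fin.elim0, Fin.elim0, fun _ => 1, 1, fun k => k.elim0, contDiff_const,
    one_pos, fun _ _ _ => rfl⟩⟩

variable (n d Y)

/-- Smooth maps `ℝᵉ → G_n^∞ Y`. -/
structure Plot (e : ℕ) where
  toFun : EuclideanSpace ℝ (Fin e) → Grassmann n d Y
  smooth' : ∀ h : Grassmann n d Y → ℝ, IsSmoothJetFun h → ContDiff ℝ ∞ (h ∘ toFun)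

variable {n d Y}

/-- `p` is the lift `j^∞ L` of an `n`-dimensional submanifold `L`, parametrized by `σ`. -/
def Plot.IsHolonomic (p : Plot n d Y n) : Prop :=
  ∃ σ : EuclideanSpace ℝ (Fin n) → Y,
    ContMDiff (𝓡 n) (𝓡∂ d) ∞ σ ∧
    (∀ x, Function.Injective (mfderiv (𝓡 n) (𝓡∂ d) σ x)) ∧
    ∀ x (f : SmoothFun d Y), f ∈ (p.toFun x).1 ↔ ∀ j : ℕ, iteratedFDeriv ℝ j (f ∘ σ) x = 0

/-- `p` takes values in `∂G_n^∞ Y`. -/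
def Plot.InBoundary {e : ℕ} (p : Plot n d Y e) : Prop :=
  ∀ x, p.toFun x ∈ grassmannBoundary n d Y

/-! ## Differential forms on `G_n^∞ Y`

A form is given through its pullbacks along all smooth maps `ℝᵉ → G_n^∞ Y`; these determine it.
-/

variable (n d Y)

/-- A collection of fields of alternating `k`-forms on the sources of all plots. -/
def FormField (k : ℕ) : Type _ :=
  ∀ e : ℕ, Plot n d Y e → EuclideanSpace ℝ (Fin e) → EuclideanSpace ℝ (Fin e) [⋀^Fin k]→L[ℝ] ℝ

instance (k : ℕ) : AddCommGroup (FormField n d Y k) :=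
  inferInstanceAs (AddCommGroup (∀ e : ℕ, Plot n d Y e → EuclideanSpace ℝ (Fin e) →
    EuclideanSpace ℝ (Fin e) [⋀^Fin k]→L[ℝ] ℝ))

instance (k : ℕ) : Module ℝ (FormField n d Y k) :=
  inferInstanceAs (Module ℝ (∀ e : ℕ, Plot n d Y e → EuclideanSpace ℝ (Fin e) →
    EuclideanSpace ℝ (Fin e) [⋀^Fin k]→L[ℝ] ℝ))

variable {n d Y}

/-- The form `h dg₁ ∧ ⋯ ∧ dgₖ`, for functions `h, g₁, …, gₖ` on `G_n^∞ Y`. -/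
def monomial {k : ℕ} (h : Grassmann n d Y → ℝ) (g : Fin k → Grassmann n d Y → ℝ) :
    FormField n d Y k :=
  fun _ p x => h (p.toFun x) • wedge fun i => fderiv ℝ (g i ∘ p.toFun) x

/-- The form `h α₁ ∧ ⋯ ∧ αₖ`, for a function `h` and `1`-forms `α₁, …, αₖ` on `G_n^∞ Y`. -/
def prodForm {k : ℕ} (h : Grassmann n d Y → ℝ) (α : Fin k → FormField n d Y 1) :
    FormField n d Y k :=
  fun e p x => h (p.toFun x) •
    wedge fun i => (ContinuousAlternatingMap.ofSubsingleton ℝ _ ℝ (0 : Fin 1)).symm (α i e p x)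

variable (n d Y)

/-- The space `Ω^k(G_n^∞ Y)` of differential `k`-forms. -/
def Form (k : ℕ) : Submodule ℝ (FormField n d Y k) :=
  Submodule.span ℝ {w | ∃ (h : Grassmann n d Y → ℝ) (g : Fin k → Grassmann n d Y → ℝ),
    IsSmoothJetFun h ∧ (∀ i, IsSmoothJetFun (g i)) ∧ w = monomial h g}

variable {n d Y}

/-- The form `y₀ dy₁ ∧ ⋯ ∧ dyₖ` on `ℝ^(k+1)`. -/
def liouville (k : ℕ) (y : Fin (k + 1) → ℝ) : (Fin (k + 1) → ℝ) [⋀^Fin k]→L[ℝ] ℝ :=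
  y 0 • wedge fun i : Fin k => ContinuousLinearMap.proj (R := ℝ) (φ := fun _ => ℝ) i.succ

theorem hasFDerivAt_liouville (k : ℕ) (y : Fin (k + 1) → ℝ) :
    HasFDerivAt (liouville k)
      ((ContinuousLinearMap.proj (R := ℝ) (φ := fun _ => ℝ) (0 : Fin (k + 1))).smulRight
        (wedge fun i : Fin k => ContinuousLinearMap.proj (R := ℝ) (φ := fun _ => ℝ) i.succ)) y :=
  ContinuousLinearMap.hasFDerivAt
    ((ContinuousLinearMap.proj (R := ℝ) (φ := fun _ => ℝ) (0 : Fin (k + 1))).smulRight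
        (wedge fun i : Fin k => ContinuousLinearMap.proj (R := ℝ) (φ := fun _ => ℝ) i.succ))

theorem extDeriv_liouville (k : ℕ) (y : Fin (k + 1) → ℝ) :
    extDeriv (liouville k) y = detForm (k + 1) := by
  ext v
  rw [extDeriv, (hasFDerivAt_liouville k y).fderiv,
    ContinuousAlternatingMap.alternatizeUncurryFin_apply, detForm_apply,
    Matrix.det_succ_column_zero]
  refine Finset.sum_congr rfl fun i _ => ?_
  rw [mul_assoc]
  have h1 : ∀ c : ℝ, ((-1 : ℤ) ^ (i : ℕ)) • c = (-1 : ℝ) ^ (i : ℕ) * c := by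
    intro c
    rw [zsmul_eq_mul]
    push_cast
    rfl
  exact h1 _

/-- A tuple of functions on `G_n^∞ Y`, restricted to a plot. -/
def Plot.tuple {e m : ℕ} (p : Plot n d Y e) (H : Fin m → Grassmann n d Y → ℝ) :
    EuclideanSpace ℝ (Fin e) → (Fin m → ℝ) :=
  fun x i => H i (p.toFun x)

theorem Plot.contDiff_tuple {e m : ℕ} (p : Plot n d Y e) {H : Fin m → Grassmann n d Y → ℝ}
    (hH : ∀ i, IsSmoothJetFun (H i)) : ContDiff ℝ ∞ (p.tuple H) :=
  contDiff_pi.2 fun i => p.smooth' (H i) (hH i)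

theorem Plot.fderiv_tuple {e m : ℕ} (p : Plot n d Y e) {H : Fin m → Grassmann n d Y → ℝ}
    (hH : ∀ i, IsSmoothJetFun (H i)) (x u : EuclideanSpace ℝ (Fin e)) (i : Fin m) :
    fderiv ℝ (p.tuple H) x u i = fderiv ℝ (H i ∘ p.toFun) x u := by
  have hd : DifferentiableAt ℝ (p.tuple H) x := (p.contDiff_tuple hH).differentiable (by simp) x
  have h1 := (hasFDerivAt_pi'.1 hd.hasFDerivAt i).fderiv
  exact (DFunLike.congr_fun h1 u).symm

theorem isSmoothJetFun_cons {k : ℕ} {h : Grassmann n d Y → ℝ} {g : Fin k → Grassmann n d Y → ℝ}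
    (hh : IsSmoothJetFun h) (hg : ∀ i, IsSmoothJetFun (g i)) (i : Fin (k + 1)) :
    IsSmoothJetFun ((Fin.cons h g : Fin (k + 1) → Grassmann n d Y → ℝ) i) := by
  refine Fin.cases ?_ (fun j => ?_) i
  · exact hh
  · exact hg j

theorem monomial_eq_pullback {k : ℕ} {h : Grassmann n d Y → ℝ} {g : Fin k → Grassmann n d Y → ℝ}
    (hh : IsSmoothJetFun h) (hg : ∀ i, IsSmoothJetFun (g i)) {e : ℕ} (p : Plot n d Y e) :
    monomial h g e p = fun x =>
      (liouville k (p.tuple (Fin.cons h g) x)).compContinuousLinearMap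
        (fderiv ℝ (p.tuple (Fin.cons h g)) x) := by
  funext x
  ext v
  simp only [monomial, liouville, ContinuousAlternatingMap.smul_apply, wedge,
    ContinuousAlternatingMap.compContinuousLinearMap_apply]
  congr 2
  funext j i
  exact (p.fderiv_tuple (isSmoothJetFun_cons hh hg) x (v j) i.succ).symm

theorem contDiff_liouville (k : ℕ) : ContDiff ℝ ∞ (liouville k) :=
  ((ContinuousLinearMap.proj (R := ℝ) (φ := fun _ => ℝ) (0 : Fin (k + 1))).smulRight
        (wedge fun i : Fin k => ContinuousLinearMap.proj (R := ℝ) (φ := fun _ => ℝ) i.succ)).contDiff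

theorem differentiable_monomial {k : ℕ} {h : Grassmann n d Y → ℝ}
    {g : Fin k → Grassmann n d Y → ℝ} (hh : IsSmoothJetFun h) (hg : ∀ i, IsSmoothJetFun (g i))
    {e : ℕ} (p : Plot n d Y e) : Differentiable ℝ (monomial h g e p) := by
  rw [monomial_eq_pullback hh hg]
  have hc := p.contDiff_tuple (isSmoothJetFun_cons hh hg)
  have h1 : Differentiable ℝ (fun x => liouville k (p.tuple (Fin.cons h g) x)) :=
    ((contDiff_liouville k).comp hc).differentiable (by simp)
  have h2 : Differentiable ℝ (fderiv ℝ (p.tuple (Fin.cons h g))) :=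
    (hc.fderiv_right (m := ∞) (by exact le_rfl)).differentiable (by simp)
  intro x
  exact ((h1 x).continuousAlternatingMapCompContinuousLinearMap (h2 x))

theorem extDeriv_monomial {k : ℕ} {h : Grassmann n d Y → ℝ} {g : Fin k → Grassmann n d Y → ℝ}
    (hh : IsSmoothJetFun h) (hg : ∀ i, IsSmoothJetFun (g i)) {e : ℕ} (p : Plot n d Y e) :
    extDeriv (monomial h g e p) = monomial (fun _ => 1) (Fin.cons h g : Fin (k + 1) → _) e p := by
  funext x
  have hc := p.contDiff_tuple (isSmoothJetFun_cons hh hg)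
  rw [monomial_eq_pullback hh hg, extDeriv_pullback (r := 2)
    ((contDiff_liouville k).differentiable (by simp) _)
    (hc.of_le (WithTop.coe_le_coe.2 le_top)).contDiffAt (by simp),
    extDeriv_liouville]
  ext v
  simp only [monomial, one_smul, wedge, ContinuousAlternatingMap.compContinuousLinearMap_apply]
  congr 1
  funext j i
  exact p.fderiv_tuple (isSmoothJetFun_cons hh hg) x (v j) i

theorem isSmoothJetFun_zero : IsSmoothJetFun (fun _ : Grassmann n d Y => (0 : ℝ)) :=
  ⟨0, fun _ _ => ⟨0, Fin.elim0, Fin.elim0, fun _ => 0, 1, fun k => k.elim0, contDiff_const,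
    one_pos, fun _ _ _ => rfl⟩⟩

variable (n d Y)

/-- The exterior derivative, plot by plot. -/
def fieldDeriv (k : ℕ) (w : FormField n d Y k) : FormField n d Y (k + 1) :=
  fun e p => extDeriv (w e p)

variable {n d Y}

theorem Form.differentiable {k : ℕ} {w : FormField n d Y k} (hw : w ∈ Form n d Y k) (e : ℕ)
    (p : Plot n d Y e) : Differentiable ℝ (w e p) := by
  induction hw using Submodule.span_induction with
  | mem w hw =>
    obtain ⟨h, g, hh, hg, rfl⟩ := hw
    exact differentiable_monomial hh hg p
  | zero => exact differentiable_const 0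
  | add a b _ _ ha hb => exact ha.add hb
  | smul c a _ ha => exact ha.const_smul c

theorem fieldDeriv_add {k : ℕ} {a b : FormField n d Y k} (ha : a ∈ Form n d Y k)
    (hb : b ∈ Form n d Y k) :
    fieldDeriv n d Y k (a + b) = fieldDeriv n d Y k a + fieldDeriv n d Y k b := by
  funext e p x
  exact extDeriv_add (Form.differentiable ha e p x) (Form.differentiable hb e p x)

theorem fieldDeriv_smul {k : ℕ} (c : ℝ) (a : FormField n d Y k) :
    fieldDeriv n d Y k (c • a) = c • fieldDeriv n d Y k a := by
  funext e p x
  exact extDeriv_smul c (a e p)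

theorem fieldDeriv_mem {k : ℕ} {w : FormField n d Y k} (hw : w ∈ Form n d Y k) :
    fieldDeriv n d Y k w ∈ Form n d Y (k + 1) := by
  induction hw using Submodule.span_induction with
  | mem w hw =>
    obtain ⟨h, g, hh, hg, rfl⟩ := hw
    refine Submodule.subset_span ⟨fun _ => 1, Fin.cons h g, isSmoothJetFun_one,
      isSmoothJetFun_cons hh hg, ?_⟩
    funext e p
    exact extDeriv_monomial hh hg p
  | zero =>
    have : fieldDeriv n d Y k 0 = 0 := by
      simpa using fieldDeriv_smul (0 : ℝ) (0 : FormField n d Y k)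
    rw [this]
    exact Submodule.zero_mem _
  | add a b ha hb iha ihb =>
    rw [fieldDeriv_add ha hb]
    exact Submodule.add_mem _ iha ihb
  | smul c a _ iha =>
    rw [fieldDeriv_smul]
    exact Submodule.smul_mem _ c iha

variable (n d Y)

/-- The exterior derivative `d : Ω^k(G_n^∞ Y) → Ω^(k+1)(G_n^∞ Y)`. -/
def formDeriv (k : ℕ) : Form n d Y k →ₗ[ℝ] Form n d Y (k + 1) where
  toFun w := ⟨fieldDeriv n d Y k w, fieldDeriv_mem w.2⟩
  map_add' a b := Subtype.ext (fieldDeriv_add a.2 b.2)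
  map_smul' c a := Subtype.ext (fieldDeriv_smul c a.1)

theorem formDeriv_formDeriv (k : ℕ) (w : Form n d Y k) :
    formDeriv n d Y (k + 1) (formDeriv n d Y k w) = 0 := by
  apply Subtype.ext
  obtain ⟨w, hw⟩ := w
  change fieldDeriv n d Y (k + 1) (fieldDeriv n d Y k w) = 0
  induction hw using Submodule.span_induction with
  | mem w hw =>
    obtain ⟨h, g, hh, hg, rfl⟩ := hw
    funext e p x
    change extDeriv (extDeriv (monomial h g e p)) x = 0
    rw [extDeriv_monomial hh hg p, extDeriv_monomial isSmoothJetFun_one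
      (isSmoothJetFun_cons hh hg) p]
    ext v
    simp only [monomial, one_smul, wedge, ContinuousAlternatingMap.compContinuousLinearMap_apply,
      detForm_apply]
    refine Matrix.det_eq_zero_of_column_eq_zero 0 fun i => ?_
    change fderiv ℝ ((fun _ => (1 : ℝ)) ∘ p.toFun) x (v i) = 0
    have : ((fun _ => (1 : ℝ)) ∘ p.toFun) = fun _ => (1 : ℝ) := rfl
    rw [this]
    simp
  | zero =>
    have h0 : ∀ k, fieldDeriv n d Y k 0 = 0 := fun k => by
      simpa using fieldDeriv_smul (0 : ℝ) (0 : FormField n d Y k)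
    rw [h0, h0]
  | add a b ha hb iha ihb =>
    rw [fieldDeriv_add ha hb, fieldDeriv_add (fieldDeriv_mem ha) (fieldDeriv_mem hb), iha, ihb,
      add_zero]
  | smul c a _ iha => rw [fieldDeriv_smul, fieldDeriv_smul, iha, smul_zero]

/-! ## Relative forms and contact forms -/

/-- Relative forms: the kernel `Ω^k(G_n^∞ Y, ∂G_n^∞ Y)` of the restriction to `∂G_n^∞ Y`. -/
def relForm (k : ℕ) : Submodule ℝ (Form n d Y k) where
  carrier := {w | ∀ (e : ℕ) (p : Plot n d Y e), p.InBoundary → w.1 e p = 0}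
  add_mem' {a b} ha hb e p hp := by
    change a.1 e p + b.1 e p = 0
    rw [ha e p hp, hb e p hp, add_zero]
  zero_mem' _ _ _ := rfl
  smul_mem' c a ha e p hp := by
    change c • a.1 e p = 0
    rw [ha e p hp, smul_zero]

variable {n d Y}

/-- Contact `1`-forms: those whose pullback along the lift `j^∞ L` of every `n`-dimensional
submanifold `L` vanishes. -/
def IsContact (α : FormField n d Y 1) : Prop :=
  α ∈ Form n d Y 1 ∧ ∀ p : Plot n d Y n, p.IsHolonomic → α n p = 0

variable (n d Y)

/-- The degree `k` part `C^pΩ^k` of the `p`-th power of the ideal generated by the contact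
`1`-forms: sums of products of `1`-forms with at least `p` contact factors. -/
def contactPower (p k : ℕ) : Submodule ℝ (Form n d Y k) :=
  (Submodule.span ℝ {w : FormField n d Y k |
    ∃ (h : Grassmann n d Y → ℝ) (α : Fin k → FormField n d Y 1) (s : Finset (Fin k)),
      IsSmoothJetFun h ∧ (∀ i, α i ∈ Form n d Y 1) ∧ p ≤ s.card ∧ (∀ i ∈ s, IsContact (α i)) ∧
      w = prodForm h α}).comap (Form n d Y k).subtype

/-! ## The relative `C`-spectral sequence -/

/-- The filtration `C^pΩ^k(G_n^∞ Y, ∂G_n^∞ Y)` of the complex of relative forms. -/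
def relFiltration (p k : ℕ) : Submodule ℝ (Form n d Y k) :=
  contactPower n d Y p k ⊓ relForm n d Y k

/-- Elements of `C^pΩ^k(rel)` with differential in `C^(p+1)Ω^(k+1)(rel)`. -/
def cocycles (p k : ℕ) : Submodule ℝ (Form n d Y k) :=
  relFiltration n d Y p k ⊓ (relFiltration n d Y (p + 1) (k + 1)).comap (formDeriv n d Y k)

/-- The image of `C^pΩ^(k-1)(rel)` under the exterior derivative (zero for `k = 0`). -/
def exactPart (p : ℕ) : (k : ℕ) → Submodule ℝ (Form n d Y k)
  | 0 => ⊥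
  | k + 1 => (relFiltration n d Y p k).map (formDeriv n d Y k)

/-- The denominator `C^(p+1)Ω^k(rel) + d C^pΩ^(k-1)(rel)`. -/
def coboundaries (p k : ℕ) : Submodule ℝ (Form n d Y k) :=
  relFiltration n d Y (p + 1) k ⊔ exactPart n d Y p k

/-- The term `E_1^{p, k - p}` of the spectral sequence of the filtered complex of relative forms,
in total degree `k`: the cohomology of `C^pΩ(rel) / C^(p+1)Ω(rel)`. -/
abbrev E1 (p k : ℕ) : Type _ :=
  cocycles n d Y p k ⧸ (coboundaries n d Y p k).submoduleOf (cocycles n d Y p k)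

theorem formDeriv_mem_cocycles {p k : ℕ} {w : Form n d Y k} (hw : w ∈ cocycles n d Y p k) :
    formDeriv n d Y k w ∈ cocycles n d Y (p + 1) (k + 1) := by
  refine ⟨hw.2, ?_⟩
  have h0 : formDeriv n d Y (k + 1) (formDeriv n d Y k w) ∈
      relFiltration n d Y (p + 1 + 1) (k + 1 + 1) := by
    rw [formDeriv_formDeriv]
    exact Submodule.zero_mem _
  exact h0

theorem formDeriv_mem_coboundaries {p k : ℕ} {w : Form n d Y k}
    (hw : w ∈ coboundaries n d Y p k) :
    formDeriv n d Y k w ∈ coboundaries n d Y (p + 1) (k + 1) := by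
  obtain ⟨a, ha, b, hb, rfl⟩ := Submodule.mem_sup.1 hw
  have hb0 : formDeriv n d Y k b = 0 := by
    cases k with
    | zero =>
      rw [(Submodule.mem_bot ℝ).1 hb, map_zero]
    | succ k =>
      obtain ⟨c, _, rfl⟩ := hb
      exact formDeriv_formDeriv n d Y k c
  rw [map_add, hb0, add_zero]
  exact Submodule.mem_sup_right ⟨a, ha, rfl⟩

/-- The differential `d_1`, induced by the exterior derivative. -/
def d1 (p k : ℕ) : E1 n d Y p k →ₗ[ℝ] E1 n d Y (p + 1) (k + 1) :=
  Submodule.mapQ _ _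
    ((formDeriv n d Y k).restrict fun _ hw => formDeriv_mem_cocycles n d Y hw)
    fun w hw => formDeriv_mem_coboundaries n d Y (w := w.1) hw

/-- `L(Y, ∂Y) = E_1^{0,n}(rel)`: relative horizontal `n`-forms (Lagrangians) modulo horizontal
differentials of relative horizontal `(n-1)`-forms. -/
abbrev LagrangianSpace : Type _ := E1 n d Y 0 n

/-- `K(Y, ∂Y) = E_1^{1,n}(rel)`, the space of relative Euler-Lagrange expressions. -/
abbrev EulerSpace : Type _ := E1 n d Y 1 (n + 1)

/-- The relative Euler map `L(Y, ∂Y) → K(Y, ∂Y)`, i.e. `d_1^{0,n}`: `[w] ↦ [dw]`. -/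
def relEuler : LagrangianSpace n d Y →ₗ[ℝ] EulerSpace n d Y :=
  d1 n d Y 0 n

end Jets

/-! ## Pullback along a diffeomorphism -/

section Pullback

variable {n d : ℕ} [NeZero d] {Y Y' : Type*} [TopologicalSpace Y]
  [ChartedSpace (EuclideanHalfSpace d) Y] [TopologicalSpace Y']
  [ChartedSpace (EuclideanHalfSpace d) Y'] (F : Y ≃ₘ^∞⟮𝓡∂ d, 𝓡∂ d⟯ Y')

/-- Pullback of functions, `f ↦ f ∘ F`. -/
def pullFun : SmoothFun d Y' →ₐ[ℝ] SmoothFun d Y where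
  toFun f := ⟨f ∘ F, f.contMDiff.comp F.contMDiff⟩
  map_one' := rfl
  map_mul' _ _ := rfl
  map_zero' := rfl
  map_add' _ _ := rfl
  commutes' _ := rfl

theorem pullFun_surjective : Function.Surjective (pullFun F) := fun f => by
  refine ⟨⟨f ∘ F.symm, f.contMDiff.comp F.symm.contMDiff⟩, ?_⟩
  ext y
  exact congrArg f (F.symm_apply_apply y)

theorem surjective_comp_pullFun {φ : Velocity n d Y} (hφ : Function.Surjective φ) :
    Function.Surjective (φ.comp (pullFun F)) :=
  hφ.comp (pullFun_surjective F)

/-- The lift `G_n^∞ Y → G_n^∞ Y'` of `F`. -/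
def lift (θ : Grassmann n d Y) : Grassmann n d Y' :=
  ⟨θ.1.comap (pullFun F), by
    obtain ⟨φ, hφ, h⟩ := θ.2
    exact ⟨φ.comp (pullFun F), surjective_comp_pullFun F hφ, by rw [← h]; rfl⟩⟩

theorem isSmoothJetFun_comp_lift {h : Grassmann n d Y' → ℝ} (hh : IsSmoothJetFun h) :
    IsSmoothJetFun (h ∘ lift F : Grassmann n d Y → ℝ) := by
  obtain ⟨r, hr⟩ := hh
  refine ⟨r, fun φ hφ => ?_⟩
  obtain ⟨N, f, I, g, ε, hI, hg, hε, H⟩ :=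
    hr (φ.comp (pullFun F)) (surjective_comp_pullFun F hφ)
  exact ⟨N, fun k => pullFun F (f k), I, g, ε, hI, hg, hε, fun ψ hψ hk =>
    H (ψ.comp (pullFun F)) (surjective_comp_pullFun F hψ) hk⟩

/-- The composition of a plot with the lift of `F`. -/
def Plot.push {e : ℕ} (p : Plot n d Y e) : Plot n d Y' e where
  toFun x := lift F (p.toFun x)
  smooth' h hh := p.smooth' (h ∘ lift F) (isSmoothJetFun_comp_lift F hh)

theorem Plot.IsHolonomic.push {p : Plot n d Y n} (hp : p.IsHolonomic) :
    (p.push F).IsHolonomic := by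
  obtain ⟨σ, hσ, hi, hf⟩ := hp
  refine ⟨F ∘ σ, F.contMDiff.comp hσ, fun x => ?_, fun x f => hf x (pullFun F f)⟩
  rw [mfderiv_comp x (F.contMDiff.mdifferentiable (by simp) _) (hσ.mdifferentiable (by simp) _)]
  exact (F.mfderivToContinuousLinearEquiv (by simp) (σ x)).injective.comp (hi x)

/-- `F` is boundary-friendly: it maps `∂Y` into `∂Y'`. -/
def BoundaryFriendly : Prop := F '' (𝓡∂ d).boundary Y ⊆ (𝓡∂ d).boundary Y'

variable {F} in
theorem Plot.InBoundary.push (hF : BoundaryFriendly F) {e : ℕ} {p : Plot n d Y e}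
    (hp : p.InBoundary) : (p.push F).InBoundary := by
  intro x
  obtain ⟨y, hy, h⟩ := hp x
  exact ⟨F y, hF ⟨y, hy, rfl⟩, fun f hf => h (pullFun F f) hf⟩

variable (n) in
/-- Pullback of fields of forms. -/
def pullField (k : ℕ) : FormField n d Y' k →ₗ[ℝ] FormField n d Y k where
  toFun w := fun e p => w e (p.push F)
  map_add' _ _ := rfl
  map_smul' _ _ := rfl

theorem pullField_mem {k : ℕ} {w : FormField n d Y' k} (hw : w ∈ Form n d Y' k) :
    pullField n F k w ∈ Form n d Y k := by
  have : Form n d Y' k ≤ (Form n d Y k).comap (pullField n F k) := by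
    refine Submodule.span_le.2 ?_
    rintro _ ⟨h, g, hh, hg, rfl⟩
    exact Submodule.subset_span ⟨h ∘ lift F, fun i => g i ∘ lift F,
      isSmoothJetFun_comp_lift F hh, fun i => isSmoothJetFun_comp_lift F (hg i), rfl⟩
  exact this hw

variable (n) in
/-- Pullback of differential forms along the lift of `F`. -/
def pullForm (k : ℕ) : Form n d Y' k →ₗ[ℝ] Form n d Y k :=
  (pullField n F k).restrict fun _ hw => pullField_mem F hw

theorem formDeriv_pullForm (k : ℕ) (w : Form n d Y' k) :
    formDeriv n d Y k (pullForm n F k w) = pullForm n F (k + 1) (formDeriv n d Y' k w) := rfl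

theorem pullForm_mem_contactPower {p k : ℕ} {w : Form n d Y' k}
    (hw : w ∈ contactPower n d Y' p k) : pullForm n F k w ∈ contactPower n d Y p k := by
  have key : ∀ S : Set (FormField n d Y k), ∀ T : Set (FormField n d Y' k),
      (∀ t ∈ T, pullField n F k t ∈ Submodule.span ℝ S) →
      ∀ w ∈ Submodule.span ℝ T, pullField n F k w ∈ Submodule.span ℝ S := fun S T h w hw =>
    (Submodule.span_le (p := (Submodule.span ℝ S).comap (pullField n F k))).2 h hw
  refine key _ _ ?_ w.1 hw
  rintro _ ⟨h, α, s, hh, hα, hs, hc, rfl⟩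
  exact Submodule.subset_span ⟨h ∘ lift F, fun i => pullField n F 1 (α i), s,
    isSmoothJetFun_comp_lift F hh, fun i => pullField_mem F (hα i), hs,
    fun i hi => ⟨pullField_mem F (hα i), fun q hq => (hc i hi).2 (q.push F) (hq.push F)⟩, rfl⟩

variable {F}

theorem pullForm_mem_relFiltration (hF : BoundaryFriendly F) {p k : ℕ} {w : Form n d Y' k}
    (hw : w ∈ relFiltration n d Y' p k) : pullForm n F k w ∈ relFiltration n d Y p k :=
  ⟨pullForm_mem_contactPower F hw.1, fun e q hq => hw.2 e (q.push F) (hq.push hF)⟩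

theorem pullForm_mem_cocycles (hF : BoundaryFriendly F) {p k : ℕ} {w : Form n d Y' k}
    (hw : w ∈ cocycles n d Y' p k) : pullForm n F k w ∈ cocycles n d Y p k :=
  ⟨pullForm_mem_relFiltration hF hw.1, pullForm_mem_relFiltration hF hw.2⟩

theorem pullForm_mem_coboundaries (hF : BoundaryFriendly F) {p k : ℕ} {w : Form n d Y' k}
    (hw : w ∈ coboundaries n d Y' p k) : pullForm n F k w ∈ coboundaries n d Y p k := by
  obtain ⟨a, ha, b, hb, rfl⟩ := Submodule.mem_sup.1 hw
  rw [map_add]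
  refine Submodule.add_mem_sup (pullForm_mem_relFiltration hF ha) ?_
  cases k with
  | zero =>
    rw [(Submodule.mem_bot ℝ).1 hb, map_zero]
    exact Submodule.zero_mem _
  | succ k =>
    obtain ⟨c, hc, rfl⟩ := hb
    exact ⟨pullForm n F k c, pullForm_mem_relFiltration hF hc, rfl⟩

variable (n) in
/-- The pullback `F^*` on the first term of the relative spectral sequence, `[w] ↦ [F^* w]`. -/
def pullE1 (hF : BoundaryFriendly F) (p k : ℕ) : E1 n d Y' p k →ₗ[ℝ] E1 n d Y p k :=
  Submodule.mapQ _ _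
    ((pullForm n F k).restrict fun _ hw => pullForm_mem_cocycles hF hw)
    fun w hw => pullForm_mem_coboundaries hF (w := w.1) hw

variable (n) in
/-- `F^* : L(Y', ∂Y') → L(Y, ∂Y)`. -/
def pullLagrangian (hF : BoundaryFriendly F) : LagrangianSpace n d Y' →ₗ[ℝ] LagrangianSpace n d Y :=
  pullE1 n hF 0 n

variable (n) in
/-- `F^* : K(Y', ∂Y') → K(Y, ∂Y)`. -/
def pullEuler (hF : BoundaryFriendly F) : EulerSpace n d Y' →ₗ[ℝ] EulerSpace n d Y :=
  pullE1 n hF 1 (n + 1)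

end Pullback

end RelEuler

end

open RelEuler

/-!
Two facts carry the proof.

A diffeomorphism has invertible differential, so it maps interior points to interior points, and
likewise for its inverse; hence it maps the boundary *onto* the boundary
(`Diffeomorph.image_boundary`), and the inverse of a boundary-friendly diffeomorphism is again
boundary-friendly (`RelEuler.boundaryFriendly_of_isManifold`, applied to the inverse).  Pullback
along the inverse therefore also preserves relative forms.  Since the lift to jets is functorial,
the two pullbacks are inverse to each other on forms, and so on every `E₁^{p,q}`
(`RelEuler.pullE1_bijective`).

The exterior derivative commutes with pullback, so `F^*` commutes with the differential `d₁`
(`RelEuler.d1_comp_pullE1`).  For `p = 0` this reads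
`E_Y^rel ∘ F^* = F^* ∘ E_Y'^rel`, and composing with `(F^*)⁻¹` gives the transformation law.
-/

namespace RelEuler

variable {n d : ℕ} [NeZero d] {Y Y' : Type*} [TopologicalSpace Y]
  [ChartedSpace (EuclideanHalfSpace d) Y] [TopologicalSpace Y']
  [ChartedSpace (EuclideanHalfSpace d) Y'] {F : Y ≃ₘ^∞⟮𝓡∂ d, 𝓡∂ d⟯ Y'}

variable (F) in
/-- Invariance of the boundary: it makes the inverse of a diffeomorphism act on relative forms. -/
theorem boundaryFriendly_of_isManifold [IsManifold (𝓡∂ d) ∞ Y] [IsManifold (𝓡∂ d) ∞ Y'] :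
    BoundaryFriendly F :=
  (F.image_boundary (by simp)).subset

variable (F) in
theorem lift_symm_lift (θ : Grassmann n d Y) : lift F.symm (lift F θ) = θ := by
  refine Subtype.ext (Ideal.ext fun f => ?_)
  change pullFun F (pullFun F.symm f) ∈ θ.1 ↔ f ∈ θ.1
  have : pullFun F (pullFun F.symm f) = f := by
    ext y
    exact congrArg f (F.symm_apply_apply y)
  rw [this]

variable (F) in
theorem Plot.push_push_symm {e : ℕ} (p : Plot n d Y e) : (p.push F).push F.symm = p := by
  cases p with
  | mk f hf =>
    simp only [Plot.push, lift_symm_lift]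

variable (F) in
theorem pullForm_pullForm_symm (k : ℕ) (w : Form n d Y k) :
    pullForm n F k (pullForm n F.symm k w) = w := by
  apply Subtype.ext
  funext e p
  exact congrArg (w.1 e) (p.push_push_symm F)

theorem pullE1_pullE1_symm (hF : BoundaryFriendly F) (hF' : BoundaryFriendly F.symm) (p k : ℕ)
    (x : E1 n d Y p k) : pullE1 n hF p k (pullE1 n hF' p k x) = x := by
  obtain ⟨w, rfl⟩ := Submodule.Quotient.mk_surjective _ x
  exact congrArg Submodule.Quotient.mk (Subtype.ext (pullForm_pullForm_symm F k w.1))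

theorem pullE1_bijective [IsManifold (𝓡∂ d) ∞ Y] [IsManifold (𝓡∂ d) ∞ Y']
    (hF : BoundaryFriendly F) (p k : ℕ) : Function.Bijective (pullE1 n hF p k) :=
  have hF' : BoundaryFriendly F.symm := boundaryFriendly_of_isManifold F.symm
  Function.bijective_iff_has_inverse.2 ⟨pullE1 n hF' p k,
    pullE1_pullE1_symm (F := F.symm) hF' hF p k, pullE1_pullE1_symm hF hF' p k⟩

/-- The differential `d₁` is natural: it commutes with pullback along boundary-friendly
diffeomorphisms. -/
theorem d1_comp_pullE1 (hF : BoundaryFriendly F) (p k : ℕ) :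
    d1 n d Y p k ∘ₗ pullE1 n hF p k = pullE1 n hF (p + 1) (k + 1) ∘ₗ d1 n d Y' p k := by
  refine LinearMap.ext fun x => ?_
  obtain ⟨w, rfl⟩ := Submodule.Quotient.mk_surjective _ x
  rfl

end RelEuler

theorem mainTheorem7 (n m : ℕ) [NeZero (n + m)]
    {Y Y' : Type*}
    [TopologicalSpace Y] [T2Space Y] [SecondCountableTopology Y]
    [ChartedSpace (EuclideanHalfSpace (n + m)) Y] [IsManifold (𝓡∂ (n + m)) ∞ Y]
    [TopologicalSpace Y'] [T2Space Y'] [SecondCountableTopology Y']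
    [ChartedSpace (EuclideanHalfSpace (n + m)) Y'] [IsManifold (𝓡∂ (n + m)) ∞ Y']
    (F : Y ≃ₘ^∞⟮𝓡∂ (n + m), 𝓡∂ (n + m)⟯ Y') (hF : BoundaryFriendly F) :
    ∃ h : Function.Bijective (pullLagrangian n hF),
      relEuler n (n + m) Y =
        pullEuler n hF ∘ₗ relEuler n (n + m) Y' ∘ₗ
          (LinearEquiv.ofBijective (pullLagrangian n hF) h).symm.toLinearMap := by
  refine ⟨pullE1_bijective hF 0 n, LinearMap.ext fun x => ?_⟩
  obtain ⟨y, rfl⟩ := (LinearEquiv.ofBijective (pullLagrangian n hF)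
    (pullE1_bijective hF 0 n)).surjective x
  simp only [LinearMap.comp_apply, LinearEquiv.coe_coe, LinearEquiv.symm_apply_apply]
  exact LinearMap.congr_fun (d1_comp_pullE1 hF 0 n) y
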